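/- Let $n, N \ge 1$ be integers and let $X = (X_{ij})$ be an $n \times N$ random complex matrix whose entries $X_{ij}$ ($1\le i\le n$, $1\le j\le N$) are independent complex random variables, bounded by $1$, i.e. $|X_{ij}| \le 1$ almost surely. Let $\lambda_1 \ge \lambda_2 \ge \cdots \ge \lambda_n$ be the $n$ eigenvalues, counted with multiplicity, of the Hermitian positive semidefinite matrix $\frac{1}{N} X X^*$, where $X^*$ is the conjugate transpose of $X$. Then for every $1 \le k \le n$ the random variable $\lambda_k$ is integrable, and for every real $t \ge 0$, $$P(\lambda_k - E\lambda_k \ge t) \le \exp\left(-\frac{N t^2}{2 n^2}\right), \qquad P(\lambda_k - E\lambda_k \le -t) \le \exp\left(-\frac{N t^2}{2 n^2}\right).$$ -/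

import Mathlib

open MeasureTheory ProbabilityTheory
open scoped Matrix

/-- The sample covariance matrix `(1/N) A A*` of an `n × N` complex matrix `A`. -/
noncomputable def sampleCov {n N : ℕ} (A : Matrix (Fin n) (Fin N) ℂ) :
    Matrix (Fin n) (Fin n) ℂ :=
  (1 / (N : ℝ)) • (A * Aᴴ)

theorem sampleCov_isHermitian {n N : ℕ} (A : Matrix (Fin n) (Fin N) ℂ) :
    (sampleCov A).IsHermitian := by
  unfold sampleCov Matrix.IsHermitian
  rw [Matrix.conjTranspose_smul, Matrix.conjTranspose_mul, Matrix.conjTranspose_conjTranspose,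
    star_trivial]

/-- The eigenvalues of `(1/N) A A*`, counted with multiplicity and listed in decreasing order:
Mathlib's `eigenvalues₀` is the antitone list of eigenvalues of a Hermitian matrix.
The index `k : Fin n` starts at `0`, so `sampleEig A k` is the `(k + 1)`-th largest eigenvalue. -/
noncomputable def sampleEig {n N : ℕ} (A : Matrix (Fin n) (Fin N) ℂ) (k : Fin n) : ℝ :=
  (sampleCov_isHermitian A).eigenvalues₀ (Fin.cast (Fintype.card_fin n).symm k)

/-!
The eigenvalue `λ_k` of `(1/N) X X*` is a function of the `N` columns of `X`, which are independent.
Since `X X*` is the sum over the columns `x` of the rank-one matrices `x x*`, replacing one column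
by another, both with entries in the unit disc, changes the quadratic form of `(1/N) X X*` by at
most `n / N` in either direction. By Weyl's monotonicity principle
(`LinearMap.IsSymmetric.eigenvalues_le_of_re_inner_le`) it moves `λ_k` by at most `n / N`
(`sampleEig_le_of_eqOn_compl_column`).

The bounded differences inequality (`hasSubgaussianMGF_pi_of_bounded_differences`) then makes
`λ_k - E λ_k` sub-Gaussian with parameter `N (n / N) ^ 2 = n ^ 2 / N`. It is proved by integrating
out one coordinate at a time, with Hoeffding's lemma on each slice. Integrability of `λ_k` and the
two tails follow, the tails by Chernoff's bound applied to `λ_k - E λ_k` and to its negative.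
-/

/-! ### Comparison of ordered eigenvalues -/

theorem LinearMap.IsSymmetric.re_inner_apply_self_eq_sum {𝕜 E : Type*} [RCLike 𝕜]
    [NormedAddCommGroup E] [InnerProductSpace 𝕜 E] [FiniteDimensional 𝕜 E] {T : E →ₗ[𝕜] E}
    (hT : T.IsSymmetric) {m : ℕ} (hm : Module.finrank 𝕜 E = m) (x : E) :
    RCLike.re (inner 𝕜 (T x) x) =
      ∑ i, hT.eigenvalues hm i * ‖inner 𝕜 (hT.eigenvectorBasis hm i) x‖ ^ 2 := by
  rw [← (hT.eigenvectorBasis hm).sum_inner_mul_inner (T x) x, map_sum]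
  refine Finset.sum_congr rfl fun i _ => ?_
  rw [hT x, hT.apply_eigenvectorBasis, inner_smul_right, mul_assoc, RCLike.re_ofReal_mul,
    inner_mul_symm_re_eq_norm, norm_mul, norm_inner_symm x, sq]

/-- Weyl's monotonicity principle: a bound between the quadratic forms of two symmetric operators
gives the same bound between their ordered eigenvalues. On a nonzero `x` orthogonal to the
eigenvectors of `S` after the `k`-th and to those of `T` before the `k`-th, the form of `S` is at
least its `k`-th eigenvalue, and that of `T` at most its `k`-th eigenvalue. -/
theorem LinearMap.IsSymmetric.eigenvalues_le_of_re_inner_le {𝕜 E : Type*} [RCLike 𝕜]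
    [NormedAddCommGroup E] [InnerProductSpace 𝕜 E] [FiniteDimensional 𝕜 E] {S T : E →ₗ[𝕜] E}
    (hS : S.IsSymmetric) (hT : T.IsSymmetric) {m : ℕ} (hm : Module.finrank 𝕜 E = m) {c : ℝ}
    (h : ∀ x, RCLike.re (inner 𝕜 (S x) x) ≤ RCLike.re (inner 𝕜 (T x) x) + c * ‖x‖ ^ 2)
    (k : Fin m) : hS.eigenvalues hm k ≤ hT.eigenvalues hm k + c := by
  let v := hS.eigenvectorBasis hm
  let w := hT.eigenvectorBasis hm
  -- `m - 1` linear conditions on a space of dimension `m` have a common nonzero solution.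
  let φ : E →ₗ[𝕜] ({j : Fin m // j ≠ k} → 𝕜) :=
    LinearMap.pi fun j => (innerSL 𝕜 (if j.1 < k then w j else v j)).toLinearMap
  have hφ : LinearMap.ker φ ≠ ⊥ := by
    apply LinearMap.ker_ne_bot_of_finrank_lt
    have := k.pos
    simp [hm]
    omega
  obtain ⟨x, hx, hx0⟩ := (Submodule.ne_bot_iff _).1 hφ
  have hφx : ∀ j (hj : j ≠ k), inner 𝕜 (if j < k then w j else v j) x = 0 := fun j hj =>
    congr_fun (LinearMap.mem_ker.1 hx) ⟨j, hj⟩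
  have hlow : hS.eigenvalues hm k * ‖x‖ ^ 2 ≤ RCLike.re (inner 𝕜 (S x) x) := by
    rw [hS.re_inner_apply_self_eq_sum hm, ← v.sum_sq_norm_inner_right x, Finset.mul_sum]
    refine Finset.sum_le_sum fun i _ => ?_
    rcases le_or_gt i k with hi | hi
    · exact mul_le_mul_of_nonneg_right (hS.eigenvalues_antitone hm hi) (by positivity)
    · have := hφx i hi.ne'
      rw [if_neg hi.not_gt] at this
      simp [v] at this ⊢
      simp [this]
  have hupp : RCLike.re (inner 𝕜 (T x) x) ≤ hT.eigenvalues hm k * ‖x‖ ^ 2 := by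
    rw [hT.re_inner_apply_self_eq_sum hm, ← w.sum_sq_norm_inner_right x, Finset.mul_sum]
    refine Finset.sum_le_sum fun i _ => ?_
    rcases le_or_gt k i with hi | hi
    · exact mul_le_mul_of_nonneg_right (hT.eigenvalues_antitone hm hi) (by positivity)
    · have := hφx i hi.ne
      rw [if_pos hi] at this
      simp [w] at this ⊢
      simp [this]
  have hpos : 0 < ‖x‖ ^ 2 := by positivity
  refine le_of_mul_le_mul_right ?_ hpos
  linarith [h x, add_mul (hT.eigenvalues hm k) c (‖x‖ ^ 2)]

theorem inner_toEuclideanLin_sampleCov {n N : ℕ} (A : Matrix (Fin n) (Fin N) ℂ)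
    (x : EuclideanSpace ℂ (Fin n)) :
    RCLike.re (inner ℂ (Matrix.toEuclideanLin (sampleCov A) x) x) =
      1 / N * ∑ j, ‖∑ i, star (A i j) * x i‖ ^ 2 := by
  have h1 : Matrix.toEuclideanLin (sampleCov A) x =
      (1 / (N : ℝ)) • WithLp.toLp 2 (A *ᵥ (Aᴴ *ᵥ x.ofLp)) := by
    rw [Matrix.toLpLin_apply, sampleCov, Matrix.smul_mulVec, Matrix.mulVec_mulVec]
    rfl
  have h2 : inner ℂ (WithLp.toLp 2 (A *ᵥ (Aᴴ *ᵥ x.ofLp))) x =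
      ∑ j, (‖∑ i, star (A i j) * x i‖ ^ 2 : ℂ) := by
    rw [EuclideanSpace.inner_eq_star_dotProduct]
    simp only [Matrix.star_mulVec]
    rw [dotProduct_comm, ← Matrix.dotProduct_mulVec]
    refine Finset.sum_congr rfl fun j _ => ?_
    have h3 : (Aᴴ *ᵥ x.ofLp) j = ∑ i, star (A i j) * x i := rfl
    have h4 : (star x.ofLp ᵥ* Aᴴᴴ) j = star (∑ i, star (A i j) * x i) := by
      rw [← h3, ← Matrix.star_mulVec]
      rfl
    rw [h3, h4, ← Complex.conj_mul']
    rfl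
  rw [h1, RCLike.real_smul_eq_coe_smul (K := ℂ), inner_smul_left, h2, RCLike.conj_ofReal,
    RCLike.re_ofReal_mul]
  norm_cast

theorem sampleEig_le_of_sum_le {n N : ℕ} {A B : Matrix (Fin n) (Fin N) ℂ} {c : ℝ}
    (h : ∀ x : Fin n → ℂ, 1 / N * ∑ j, ‖∑ i, star (A i j) * x i‖ ^ 2 ≤
      1 / N * ∑ j, ‖∑ i, star (B i j) * x i‖ ^ 2 + c * ∑ i, ‖x i‖ ^ 2) (k : Fin n) :
    sampleEig A k ≤ sampleEig B k + c := by
  refine LinearMap.IsSymmetric.eigenvalues_le_of_re_inner_le _ _ _ (fun x => ?_) _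
  rw [inner_toEuclideanLin_sampleCov, inner_toEuclideanLin_sampleCov, EuclideanSpace.norm_sq_eq]
  exact h x

/-- Changing one column moves an eigenvalue up by at most `n / N`: only the rank-one term of that
column changes, and it is bounded by `n / N` as a quadratic form. -/
theorem sampleEig_le_of_eqOn_compl_column {n N : ℕ} {A B : Matrix (Fin n) (Fin N) ℂ}
    (j : Fin N) (hAB : ∀ i l, l ≠ j → A i l = B i l) (hA : ∀ i, ‖A i j‖ ≤ 1) (k : Fin n) :
    sampleEig A k ≤ sampleEig B k + n / N := by
  refine sampleEig_le_of_sum_le (fun x => ?_) k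
  have hcol : ‖∑ i, star (A i j) * x i‖ ^ 2 ≤ n * ∑ i, ‖x i‖ ^ 2 := by
    calc ‖∑ i, star (A i j) * x i‖ ^ 2 ≤ (∑ i, ‖x i‖) ^ 2 := by
          gcongr
          refine norm_sum_le_of_le _ fun i _ => ?_
          rw [norm_mul, norm_star]
          exact mul_le_of_le_one_left (norm_nonneg _) (hA i)
      _ ≤ n * ∑ i, ‖x i‖ ^ 2 := by
          simpa using sq_sum_le_card_mul_sum_sq (s := Finset.univ) (f := fun i => ‖x i‖)
  have hsum : ∑ l, ‖∑ i, star (A i l) * x i‖ ^ 2 ≤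
      ∑ l, ‖∑ i, star (B i l) * x i‖ ^ 2 + n * ∑ i, ‖x i‖ ^ 2 := by
    rw [← Finset.add_sum_erase _ _ (Finset.mem_univ j),
      ← Finset.add_sum_erase (a := j) _ (fun l => ‖∑ i, star (B i l) * x i‖ ^ 2)
        (Finset.mem_univ j)]
    have hrest : ∑ l ∈ Finset.univ.erase j, ‖∑ i, star (A i l) * x i‖ ^ 2 =
        ∑ l ∈ Finset.univ.erase j, ‖∑ i, star (B i l) * x i‖ ^ 2 :=
      Finset.sum_congr rfl fun l hl => by simp_rw [hAB _ l (Finset.ne_of_mem_erase hl)]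
    linarith [sq_nonneg ‖∑ i, star (B i j) * x i‖]
  calc 1 / (N : ℝ) * ∑ l, ‖∑ i, star (A i l) * x i‖ ^ 2
      ≤ 1 / N * (∑ l, ‖∑ i, star (B i l) * x i‖ ^ 2 + n * ∑ i, ‖x i‖ ^ 2) := by gcongr
    _ = _ := by ring

/-- Ordered eigenvalues are `1`-Lipschitz for the operator norm, hence continuous in the entries;
this is what makes them random variables. -/
theorem continuous_sampleEig {n N : ℕ} (k : Fin n) :
    Continuous fun A : Fin n → Fin N → ℂ => sampleEig (Matrix.of A) k := by
  let Φ : (Fin n → Fin N → ℂ) → (EuclideanSpace ℂ (Fin n) →L[ℂ] EuclideanSpace ℂ (Fin n)) :=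
    fun A => (Matrix.toEuclideanLin (sampleCov (Matrix.of A))).toContinuousLinearMap
  have hΦ : Continuous Φ := by
    have h1 : Continuous fun A : Fin n → Fin N → ℂ => sampleCov (Matrix.of A) := by
      have h2 : Continuous fun A : Fin n → Fin N → ℂ => Matrix.of A := continuous_id
      unfold sampleCov
      fun_prop
    have h2 : Continuous fun M : Matrix (Fin n) (Fin n) ℂ =>
        (Matrix.toEuclideanLin M).toContinuousLinearMap :=
      (Matrix.toEuclideanLin.trans LinearMap.toContinuousLinearMap :
        Matrix (Fin n) (Fin n) ℂ ≃ₗ[ℂ]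
          (EuclideanSpace ℂ (Fin n) →L[ℂ] EuclideanSpace ℂ (Fin n))).toLinearMap
        |>.continuous_of_finiteDimensional
    exact h2.comp h1
  have hle : ∀ A B, sampleEig (Matrix.of A) k ≤ sampleEig (Matrix.of B) k + ‖Φ A - Φ B‖ := by
    intro A B
    refine LinearMap.IsSymmetric.eigenvalues_le_of_re_inner_le _ _ _ (fun x => ?_) _
    have h1 : RCLike.re (inner ℂ ((Φ A - Φ B) x) x) ≤ ‖Φ A - Φ B‖ * ‖x‖ ^ 2 :=
      calc _ ≤ ‖(Φ A - Φ B) x‖ * ‖x‖ := re_inner_le_norm _ _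
        _ ≤ ‖Φ A - Φ B‖ * ‖x‖ * ‖x‖ := by gcongr; exact (Φ A - Φ B).le_opNorm x
        _ = _ := by ring
    rw [sub_apply, inner_sub_left, map_sub] at h1
    have h2 : ∀ C, Matrix.toEuclideanLin (sampleCov (Matrix.of C)) x = Φ C x := fun _ => rfl
    rw [h2, h2]
    linarith
  refine continuous_iff_continuousAt.2 fun B => ?_
  have hlim : Filter.Tendsto (fun A => ‖Φ A - Φ B‖) (nhds B) (nhds 0) :=
    tendsto_iff_norm_sub_tendsto_zero.1 hΦ.continuousAt
  refine tendsto_iff_norm_sub_tendsto_zero.2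
    (squeeze_zero (fun _ => norm_nonneg _) (fun A => ?_) hlim)
  rw [Real.norm_eq_abs, abs_le]
  constructor <;> linarith [hle A B, (hle B A).trans_eq (by rw [norm_sub_rev])]

/-! ### The bounded differences inequality -/

theorem integrable_of_oscillation_le {α : Type*} [MeasurableSpace α] {P : Measure α}
    [IsProbabilityMeasure P] {h : α → ℝ} (hh : Measurable h) {c : ℝ}
    (hc : ∀ a a', |h a - h a'| ≤ c) : Integrable h P := by
  obtain ⟨a₀⟩ := P.nonempty_of_neZero
  refine Integrable.of_bound hh.aestronglyMeasurable (|h a₀| + c) (ae_of_all _ fun a => ?_)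
  rw [Real.norm_eq_abs]
  linarith [hc a a₀, abs_sub_abs_le_abs_sub (h a) (h a₀)]

/-- The inductive step of the bounded differences inequality: integrating out a coordinate in
which `F` oscillates by at most `c` costs `c ^ 2` in the sub-Gaussian parameter, whatever the
centring constant `m`. -/
theorem hasSubgaussianMGF_prod_of_oscillation_le {α β : Type*} [MeasurableSpace α]
    [MeasurableSpace β] {P : Measure α} {Q : Measure β} [IsProbabilityMeasure P]
    [IsProbabilityMeasure Q] {F : α × β → ℝ} (hF : Measurable F) {c d : NNReal} {m : ℝ}
    (hc : ∀ a a' y, |F (a, y) - F (a', y)| ≤ c)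
    (hg : HasSubgaussianMGF (fun y => ∫ a, F (a, y) ∂P - m) d Q) :
    HasSubgaussianMGF (fun p => F p - m) (c ^ 2 + d) (P.prod Q) := by
  set g : β → ℝ := fun y => ∫ a, F (a, y) ∂P with hgdef
  have hFy : ∀ y, Measurable fun a => F (a, y) := fun y => hF.comp (by fun_prop)
  have hint : ∀ y, Integrable (fun a => F (a, y)) P := fun y =>
    integrable_of_oscillation_le (hFy y) fun a a' => hc a a' y
  have hdev : ∀ a y, |F (a, y) - g y| ≤ c := by
    intro a y
    have h1 : F (a, y) - g y = ∫ a', (F (a, y) - F (a', y)) ∂P := by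
      rw [integral_sub (integrable_const _) (hint y)]
      simp [hgdef]
    rw [h1, ← Real.norm_eq_abs]
    simpa using norm_integral_le_of_norm_le_const (μ := P)
      (ae_of_all _ fun a' => (Real.norm_eq_abs _).trans_le (hc a a' y))
  -- Hoeffding's lemma on each slice, centred at the slice average.
  have hslice : ∀ y, HasSubgaussianMGF (fun a => F (a, y) - g y) (c ^ 2) P := by
    intro y
    have := hasSubgaussianMGF_of_mem_Icc_of_integral_eq_zero (μ := P) (a := -(c : ℝ)) (b := c)
      ((hFy y).sub_const (g y)).aemeasurable (ae_of_all _ fun a => abs_le.1 (hdev a y))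
      (by rw [integral_sub (hint y) (integrable_const _)]; simp [hgdef])
    convert this using 2
    ext
    simp
    rw [abs_of_nonneg (by positivity)]
    ring
  have hexp : ∀ t, Integrable (fun p : α × β => Real.exp (t * (F p - m))) (P.prod Q) := by
    intro t
    -- `F - g` is bounded by `c`, so `exp (t * F)` is dominated by a multiple of `exp (t * g)`.
    have hdom : Integrable (fun p : α × β => Real.exp (|t| * c) * Real.exp (t * (g p.2 - m)))
        (P.prod Q) := ((hg.integrable_exp_mul t).comp_snd P).const_mul _
    refine hdom.mono' (by fun_prop) (ae_of_all _ fun p => ?_)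
    rw [Real.norm_eq_abs, Real.abs_exp, ← Real.exp_add, Real.exp_le_exp]
    have h1 : t * (F p - g p.2) ≤ |t| * c :=
      (le_abs_self _).trans (by rw [abs_mul]; gcongr; exact hdev p.1 p.2)
    linarith
  refine ⟨hexp, fun t => ?_⟩
  calc mgf (fun p => F p - m) (P.prod Q) t
      = ∫ y, ∫ a, Real.exp (t * (F (a, y) - m)) ∂P ∂Q := integral_prod_symm _ (hexp t)
    _ = ∫ y, Real.exp (t * (g y - m)) * mgf (fun a => F (a, y) - g y) P t ∂Q := by
        refine integral_congr_ae (ae_of_all _ fun y => ?_)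
        simp only [mgf]
        rw [← integral_const_mul]
        refine integral_congr_ae (ae_of_all _ fun a => ?_)
        simp only
        rw [← Real.exp_add]
        ring_nf
    _ ≤ ∫ y, Real.exp (t * (g y - m)) * Real.exp ((c ^ 2 : NNReal) * t ^ 2 / 2) ∂Q := by
        refine integral_mono_of_nonneg (ae_of_all _ fun y => ?_)
          ((hg.integrable_exp_mul t).mul_const _) (ae_of_all _ fun y => ?_)
        · exact mul_nonneg (Real.exp_nonneg _) mgf_nonneg
        · exact mul_le_mul_of_nonneg_left ((hslice y).mgf_le t) (Real.exp_nonneg _)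
    _ = mgf (fun y => g y - m) Q t * Real.exp ((c ^ 2 : NNReal) * t ^ 2 / 2) :=
        integral_mul_const _ _
    _ ≤ Real.exp (d * t ^ 2 / 2) * Real.exp ((c ^ 2 : NNReal) * t ^ 2 / 2) := by
        gcongr
        exact hg.mgf_le t
    _ = _ := by
        rw [← Real.exp_add]
        push_cast
        ring_nf

/-- McDiarmid's inequality, at the level of moment generating functions: a function of independent
coordinates that moves by at most `c i` when the `i`-th one changes is sub-Gaussian around its mean.
The optimal parameter is a quarter of this one: the deviation of a slice from its average is
only placed in `[-c i, c i]`, an interval of twice the necessary length. -/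
theorem hasSubgaussianMGF_pi_of_bounded_differences {N : ℕ} {E : Fin N → Type*}
    [∀ i, MeasurableSpace (E i)] (ν : ∀ i, Measure (E i)) [∀ i, IsProbabilityMeasure (ν i)]
    {f : (∀ i, E i) → ℝ} (hf : Measurable f) (c : Fin N → NNReal)
    (hc : ∀ x i v, |f (Function.update x i v) - f x| ≤ c i) :
    HasSubgaussianMGF (fun x => f x - ∫ y, f y ∂Measure.pi ν) (∑ i, c i ^ 2) (Measure.pi ν) := by
  induction N with
  | zero =>
    have h0 : (fun x => f x - ∫ y, f y ∂Measure.pi ν) = fun _ => 0 := by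
      funext x
      have : f = fun _ => f x := funext fun y => congrArg f (Subsingleton.elim y x)
      rw [this]
      simp
    rw [h0]
    simp
  | succ N ih =>
    let e := MeasurableEquiv.piFinSuccAbove E 0
    have he : MeasurePreserving e (Measure.pi ν)
        ((ν 0).prod (Measure.pi fun j => ν (Fin.succAbove 0 j))) :=
      measurePreserving_piFinSuccAbove ν 0
    let F : E 0 × (∀ j, E (Fin.succAbove 0 j)) → ℝ := fun p => f (e.symm p)
    have hF : Measurable F := hf.comp e.symm.measurable
    have hFe : ∀ x, F (e x) = f x := fun x => congrArg f (e.symm_apply_apply x)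
    have hsymm : ∀ a y, e.symm (a, y) = Fin.insertNth 0 a y := fun a y => rfl
    have hF0 : ∀ a a' y, |F (a, y) - F (a', y)| ≤ c 0 := by
      intro a a' y
      have := hc (e.symm (a', y)) 0 a
      rwa [hsymm, Fin.update_insertNth] at this
    have hint : ∀ y, Integrable (fun a => F (a, y)) (ν 0) := fun y =>
      integrable_of_oscillation_le (hF.comp (by fun_prop)) fun a a' => hF0 a a' y
    have hFs : ∀ a y i v, |F (a, Function.update y i v) - F (a, y)| ≤ c (Fin.succAbove 0 i) := by
      intro a y i v
      have := hc (e.symm (a, y)) (Fin.succAbove 0 i) v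
      rwa [hsymm, ← Fin.insertNth_update] at this
    have hg := ih (fun j => ν (Fin.succAbove 0 j)) (f := fun y => ∫ a, F (a, y) ∂ν 0)
      hF.stronglyMeasurable.integral_prod_left.measurable (fun j => c (Fin.succAbove 0 j)) (by
        intro y i v
        rw [← integral_sub (hint _) (hint _), ← Real.norm_eq_abs]
        simpa using norm_integral_le_of_norm_le_const (μ := ν 0)
          (ae_of_all _ fun a => (Real.norm_eq_abs _).trans_le (hFs a y i v)))
    -- Oscillation in coordinate `0`, and the induction hypothesis for the slice averages.
    have hprod := hasSubgaussianMGF_prod_of_oscillation_le hF hF0 hg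
    have hFint : Integrable F ((ν 0).prod (Measure.pi fun j => ν (Fin.succAbove 0 j))) := by
      have h := hprod.integrable
      simp only [sub_eq_add_neg] at h
      exact integrable_add_const_iff.1 h
    have hmean : ∫ x, f x ∂Measure.pi ν =
        ∫ y, ∫ a, F (a, y) ∂ν 0 ∂Measure.pi fun j => ν (Fin.succAbove 0 j) := by
      rw [← integral_prod_symm F hFint, ← he.integral_comp' F]
      simp only [hFe]
    rw [← he.map_eq] at hprod
    have := hprod.of_map he.measurable.aemeasurable
    rw [hmean, Fin.sum_univ_succAbove _ 0]
    convert this using 1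
    funext x
    simp only [Function.comp_apply, hFe]

/-! ### Independent columns -/

/-- If the entries of a random matrix are independent, then so are its columns: the law of the
family of columns is the product of their laws. -/
theorem ProbabilityTheory.iIndepFun.map_pi_eq_pi_map {Ω ι κ : Type*} [Fintype ι] [Fintype κ]
    [MeasurableSpace Ω] {μ : Measure Ω} [IsProbabilityMeasure μ] {E : Type*} [MeasurableSpace E]
    {X : ι → κ → Ω → E} (hmeas : ∀ i j, Measurable (X i j))
    (hindep : iIndepFun (fun p : ι × κ => X p.1 p.2) μ) :
    μ.map (fun ω j i => X i j ω) = Measure.pi fun j => μ.map fun ω i => X i j ω := by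
  have hσ : iIndepFun (fun p : (_ : κ) × ι => X p.2 p.1) μ :=
    hindep.precomp (g := fun p : (_ : κ) × ι => (p.2, p.1)) (by
      rintro ⟨a, b⟩ ⟨a', b'⟩ h
      simp_all)
  have hcol : ∀ j, iIndepFun (fun i => X i j) μ := fun j =>
    hindep.precomp (g := fun i => (i, j)) fun _ _ h => (Prod.mk.inj h).1
  have (i : ι) (j : κ) : IsProbabilityMeasure (μ.map (X i j)) :=
    Measure.isProbabilityMeasure_map (hmeas i j).aemeasurable
  have (j : κ) : IsProbabilityMeasure (μ.map fun ω i => X i j ω) :=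
    Measure.isProbabilityMeasure_map (by fun_prop)
  have h1 := (iIndepFun_iff_map_fun_eq_infinitePi_map fun p : (_ : κ) × ι => hmeas p.2 p.1).1 hσ
  have h2 := Measure.infinitePi_map_piCurry (X := fun (_ : κ) (_ : ι) => E)
    fun j i => μ.map (X i j)
  rw [← h1, Measure.map_map (MeasurableEquiv.measurable _) (by fun_prop)] at h2
  rw [← Measure.infinitePi_eq_pi]
  refine h2.trans ?_
  congr 1
  funext j
  exact ((iIndepFun_iff_map_fun_eq_infinitePi_map fun i => hmeas i j).1 (hcol j)).symm

/-! ### Concentration of the eigenvalues -/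

/-- Truncation of a complex number to the closed unit disc: points outside are sent to `0`. It turns
the almost sure bound on the entries into a bound valid at every point of the product space. -/
noncomputable def truncUnitBall (z : ℂ) : ℂ := if ‖z‖ ≤ 1 then z else 0

theorem measurable_truncUnitBall : Measurable truncUnitBall :=
  Measurable.ite (measurableSet_le measurable_norm measurable_const) measurable_id
    measurable_const

theorem norm_truncUnitBall_le (z : ℂ) : ‖truncUnitBall z‖ ≤ 1 := by
  unfold truncUnitBall
  split_ifs with h
  · exact h
  · simp

theorem truncUnitBall_of_norm_le {z : ℂ} (h : ‖z‖ ≤ 1) : truncUnitBall z = z := if_pos h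

/-- The parameter is the sum over the `N` columns of `(n / N) ^ 2`. -/
theorem hasSubgaussianMGF_sampleEig {Ω : Type*} [MeasurableSpace Ω] {μ : Measure Ω}
    [IsProbabilityMeasure μ] {n N : ℕ} {X : Fin n → Fin N → Ω → ℂ}
    (hmeas : ∀ i j, Measurable (X i j))
    (hindep : iIndepFun (fun p : Fin n × Fin N => X p.1 p.2) μ)
    (hbound : ∀ i j, ∀ᵐ ω ∂μ, ‖X i j ω‖ ≤ 1) (k : Fin n) :
    HasSubgaussianMGF (fun ω => sampleEig (Matrix.of fun i j => X i j ω) k -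
      ∫ ω', sampleEig (Matrix.of fun i j => X i j ω') k ∂μ) (n ^ 2 / N) μ := by
  let Y : Ω → Fin N → Fin n → ℂ := fun ω j i => X i j ω
  let f : (Fin N → Fin n → ℂ) → ℝ := fun y =>
    sampleEig (Matrix.of fun i j => truncUnitBall (y j i)) k
  have hY : Measurable Y := by fun_prop
  have hf : Measurable f := (continuous_sampleEig k).measurable.comp
    (measurable_pi_lambda _ fun i => measurable_pi_lambda _ fun j =>
      measurable_truncUnitBall.comp (by fun_prop))
  have hfY : ∀ᵐ ω ∂μ, f (Y ω) = sampleEig (Matrix.of fun i j => X i j ω) k := by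
    filter_upwards [ae_all_iff.2 fun i => ae_all_iff.2 fun j => hbound i j] with ω hω
    simp only [f, Y, truncUnitBall_of_norm_le (hω _ _)]
  have hmap : μ.map Y = Measure.pi fun j => μ.map fun ω i => X i j ω :=
    iIndepFun.map_pi_eq_pi_map hmeas hindep
  have (j : Fin N) : IsProbabilityMeasure (μ.map fun ω i => X i j ω) :=
    Measure.isProbabilityMeasure_map (by fun_prop)
  have hdiff : ∀ (y : Fin N → Fin n → ℂ) (j : Fin N) (v : Fin n → ℂ),
      |f (Function.update y j v) - f y| ≤ ((n / N : NNReal) : ℝ) := by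
    intro y j v
    have hoff : ∀ i l, l ≠ j → truncUnitBall (Function.update y j v l i) = truncUnitBall (y l i) :=
      fun i l hl => by rw [Function.update_of_ne hl]
    have h1 : f (Function.update y j v) ≤ f y + n / N :=
      sampleEig_le_of_eqOn_compl_column j hoff (fun _ => norm_truncUnitBall_le _) k
    have h2 : f y ≤ f (Function.update y j v) + n / N :=
      sampleEig_le_of_eqOn_compl_column j (fun i l hl => (hoff i l hl).symm)
        (fun _ => norm_truncUnitBall_le _) k
    rw [abs_le]
    push_cast
    constructor <;> linarith
  have hsub := hasSubgaussianMGF_pi_of_bounded_differences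
    (fun j => μ.map fun ω i => X i j ω) hf (fun _ => (n / N : NNReal)) hdiff
  rw [← hmap] at hsub
  have hmean : ∫ y, f y ∂μ.map Y = ∫ ω, sampleEig (Matrix.of fun i j => X i j ω) k ∂μ := by
    rw [integral_map hY.aemeasurable hf.aestronglyMeasurable]
    exact integral_congr_ae hfY
  have hconst : ∑ _j : Fin N, (n / N : NNReal) ^ 2 = n ^ 2 / N := by
    rcases eq_or_ne N 0 with rfl | hN
    · simp
    · have : (N : NNReal) ≠ 0 := Nat.cast_ne_zero.2 hN
      simp
      field_simp
  rw [hmean, hconst] at hsub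
  refine (hsub.of_map hY.aemeasurable).congr ?_
  filter_upwards [hfY] with ω hω
  simp only [Function.comp_apply, hω]

/-- For `1 ≤ k ≤ n`, the `k`-th largest eigenvalue is `sampleEig _ ⟨k - 1, _⟩`. -/
theorem theorem2 {Ω : Type*} [MeasurableSpace Ω] (μ : Measure Ω) [IsProbabilityMeasure μ]
    (n N k : ℕ) (hN : 1 ≤ N) (hk : 1 ≤ k) (hkn : k ≤ n)
    (X : Fin n → Fin N → Ω → ℂ)
    (hmeas : ∀ i j, Measurable (X i j))
    (hindep : iIndepFun (fun p : Fin n × Fin N => X p.1 p.2) μ)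
    (hbound : ∀ i j, ∀ᵐ ω ∂μ, ‖X i j ω‖ ≤ 1)
    (lam : Ω → ℝ)
    (hlam : lam = fun ω => sampleEig (Matrix.of fun i j => X i j ω) ⟨k - 1, by omega⟩) :
    Integrable lam μ ∧
      ∀ t : ℝ, 0 ≤ t →
        μ.real {ω | lam ω - ∫ ω', lam ω' ∂μ ≥ t} ≤
            Real.exp (-((N : ℝ) * t ^ 2 / (2 * (n : ℝ) ^ 2))) ∧
          μ.real {ω | lam ω - ∫ ω', lam ω' ∂μ ≤ -t} ≤
            Real.exp (-((N : ℝ) * t ^ 2 / (2 * (n : ℝ) ^ 2))) := by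
  have hsub : HasSubgaussianMGF (fun ω => lam ω - ∫ ω', lam ω' ∂μ) (n ^ 2 / N) μ := by
    rw [hlam]
    exact hasSubgaussianMGF_sampleEig hmeas hindep hbound _
  have hN' : (N : ℝ) ≠ 0 := by positivity
  have hn' : (n : ℝ) ≠ 0 := Nat.cast_ne_zero.2 (by omega)
  have hexp : ∀ t : ℝ, -t ^ 2 / (2 * ((n ^ 2 / N : NNReal) : ℝ)) =
      -((N : ℝ) * t ^ 2 / (2 * (n : ℝ) ^ 2)) := by
    intro t
    push_cast
    field_simp
  refine ⟨?_, fun t ht => ⟨?_, ?_⟩⟩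
  · have h := hsub.integrable
    simp only [sub_eq_add_neg] at h
    exact integrable_add_const_iff.1 h
  · rw [← hexp]
    exact hsub.measure_ge_le ht
  · rw [← hexp]
    refine (measureReal_mono fun ω hω => ?_).trans (hsub.neg.measure_ge_le ht)
    have h : lam ω - ∫ ω', lam ω' ∂μ ≤ -t := hω
    exact le_neg_of_le_neg h
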